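/- Let $\mathcal C$ and $\mathcal D$ be abelian categories with enough projective and enough injective objects, and let $(F,G)$ be an adjoint pair of functors $F\colon\mathcal C\to\mathcal D$, $G\colon\mathcal D\to\mathcal C$, with adjunction $\psi_{C,D}\colon \operatorname{Hom}_{\mathcal D}(F(C),D)\to\operatorname{Hom}_{\mathcal C}(C,G(D))$. Assume that $F$ is exact and preserves projective objects. For $\theta\in\operatorname{Ext}^n(Y,Z)$ and $\eta\in\operatorname{Ext}^m(X,Y)$ let $\theta\cdot\eta\in\operatorname{Ext}^{m+n}(X,Z)$ denote their Yoneda product. Write $\operatorname{Ext}^*(X,Y)=\bigoplus_{i\ge 0}\operatorname{Ext}^i(X,Y)$ and $\operatorname{Ext}^{\ge n}(X,Y)=\bigoplus_{i\ge n}\operatorname{Ext}^i(X,Y)$; the Yoneda product makes $\operatorname{Ext}^*(X,X)$ a ring, and makes $\operatorname{Ext}^*(X,Y)$ and $\operatorname{Ext}^{\ge n}(X,Y)$ right modules over it. (a) The adjunction induces isomorphisms of abelian groups $\psi\colon\operatorname{Ext}^i_{\mathcal D}(F(C),D)\simeq\operatorname{Ext}^i_{\mathcal C}(C,G(D))$ for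 all $i\ge 0$, $C\in\mathcal C$ and $D\in\mathcal D$, functorial in $C$ and $D$. For $i=0$, $\psi$ is the given adjunction $\psi_{C,D}$; and for every projective resolution $P_\bullet\to C$, $\psi$ sends the class of a cocycle $f\colon F(P_i)\to D$ on the projective resolution $F(P_\bullet)\to F(C)$ to the class of the cocycle $\psi_{P_i,D}(f)\colon P_i\to G(D)$. (b) For these isomorphisms $\psi$, all $m,n\ge 0$, all objects $C,C'$ of $\mathcal C$ and $D$ of $\mathcal D$, and all $\eta\in\operatorname{Ext}^m_{\mathcal C}(C',C)$ and $\theta\in\operatorname{Ext}^n_{\mathcal C}(C,G(D))$, the equality $$\psi^{-1}(\theta)\cdot F(\eta)=\psi^{-1}(\theta\cdot\eta)$$ holds in $\operatorname{Ext}^{m+n}_{\mathcal D}(F(C'),D)$. (c) Let $n\ge 0$, $C\in\mathcal C$ and $D\in\mathcal D$. If $\operatorname{Ext}^{\ge n}_{\mathcal C}(C,G(D))$ is a finitely generated right $\operatorname{Ext}^*_{\mathcal C}(C,C)$-module, then $\operatorname{Ext}^{\ge n}_{\mathcal D}(F(C),D)$ is a finitely generated right $\operatorname{Ext}^*_{\mathcal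 D}(F(C),F(C))$-module. (d) Let $C\in\mathcal C$. If $\operatorname{Ext}^*_{\mathcal C}(C,C)$ is a right Noetherian ring and $\operatorname{Ext}^*_{\mathcal C}(C,G(F(C)))$ is a finitely generated right $\operatorname{Ext}^*_{\mathcal C}(C,C)$-module, then $\operatorname{Ext}^*_{\mathcal D}(F(C),F(C))$ is a right Noetherian ring. -/

import Mathlib

open CategoryTheory CategoryTheory.Abelian
open scoped DirectSum

universe w w' v v' u u'

noncomputable section

namespace YonedaExt

variable {A : Type u} [Category.{v} A] [Abelian A] [HasExt.{w} A]

/-- The total Ext group `Ext^*(X, Y)`, the direct sum of all `Ext^n(X, Y)` for `n ≥ 0`. -/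
def ExtStar (X Y : A) : Type w := ⨁ n : ℕ, Ext.{w} X Y n

instance (X Y : A) : AddCommGroup (ExtStar.{w} X Y) :=
  inferInstanceAs (AddCommGroup (⨁ n : ℕ, Ext.{w} X Y n))

/-- The inclusion of `Ext^n(X, Y)` into `Ext^*(X, Y)`. -/
def of (X Y : A) (n : ℕ) : Ext.{w} X Y n →+ ExtStar.{w} X Y :=
  DirectSum.of (fun n : ℕ => Ext.{w} X Y n) n

/-- The component in `Ext^n(X, Y)` of an element of `Ext^*(X, Y)`. -/
def component (X Y : A) (n : ℕ) : ExtStar.{w} X Y →+ Ext.{w} X Y n :=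
  DFinsupp.evalAddMonoidHom (β := fun n : ℕ => Ext.{w} X Y n) n

lemma component_of_same (X Y : A) (n : ℕ) (x : Ext.{w} X Y n) :
    component X Y n (of X Y n x) = x :=
  DirectSum.of_eq_same (β := fun n : ℕ => Ext.{w} X Y n) n x

lemma component_of_ne (X Y : A) {n m : ℕ} (h : n ≠ m) (x : Ext.{w} X Y n) :
    component X Y m (of X Y n x) = 0 :=
  DirectSum.of_eq_of_ne (β := fun n : ℕ => Ext.{w} X Y n) n m x h.symm

/-- Additive maps out of `Ext^*(X, Y)` are given degreewise. -/
def lift {X Y : A} {M : Type*} [AddCommMonoid M] (f : ∀ n, Ext.{w} X Y n →+ M) :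
    ExtStar.{w} X Y →+ M :=
  DirectSum.toAddMonoid (β := fun n : ℕ => Ext.{w} X Y n) f

@[simp]
lemma lift_of {X Y : A} {M : Type*} [AddCommMonoid M] (f : ∀ n, Ext.{w} X Y n →+ M) (n : ℕ)
    (x : Ext.{w} X Y n) : lift f (of X Y n x) = f n x :=
  DirectSum.toAddMonoid_of (β := fun n : ℕ => Ext.{w} X Y n) f n x

lemma induction_on {X Y : A} {p : ExtStar.{w} X Y → Prop} (x : ExtStar.{w} X Y)
    (zero : p 0) (of : ∀ n (a : Ext.{w} X Y n), p (of X Y n a))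
    (add : ∀ a b, p a → p b → p (a + b)) : p x :=
  DirectSum.induction_on (β := fun n : ℕ => Ext.{w} X Y n) x zero of add

/-- The Yoneda product `θ · η ∈ Ext^*(X, Z)` of `θ ∈ Ext^*(Y, Z)` and `η ∈ Ext^*(X, Y)`,
written like a composition of maps: `η` is applied first. In Mathlib, `η.comp θ` is the
composition in diagrammatic order. -/
def yoneda (X Y Z : A) : ExtStar.{w} Y Z →+ ExtStar.{w} X Y →+ ExtStar.{w} X Z :=
  lift fun n => AddMonoidHom.flip <| lift fun m =>
    (AddMonoidHom.compHom (of X Z (m + n))).comp (Ext.bilinearComp X Y Z m n (m + n) rfl)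

lemma yoneda_of_of {X Y Z : A} {m n : ℕ} (θ : Ext.{w} Y Z n) (η : Ext.{w} X Y m) :
    yoneda X Y Z (of Y Z n θ) (of X Y m η) = of X Z (m + n) (η.comp θ rfl) := by
  simp [yoneda]

lemma of_comp_eq {X Y Z : A} {a b c d : ℕ} (α : Ext.{w} X Y a) (β : Ext.{w} Y Z b)
    (hc : a + b = c) (hd : a + b = d) :
    of X Z c (α.comp β hc) = of X Z d (α.comp β hd) := by
  subst hc; subst hd; rfl

lemma yoneda_assoc {X Y Z T : A} (a : ExtStar.{w} Z T) (b : ExtStar.{w} Y Z)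
    (c : ExtStar.{w} X Y) :
    yoneda X Y T (yoneda Y Z T a b) c = yoneda X Z T a (yoneda X Y Z b c) := by
  induction a using induction_on with
  | zero => simp
  | add a a' h h' => simp [h, h']
  | of i a =>
    induction b using induction_on with
    | zero => simp
    | add b b' h h' => simp [h, h']
    | of j b =>
      induction c using induction_on with
      | zero => simp
      | add c c' h h' => simp [h, h']
      | of k c =>
        rw [yoneda_of_of, yoneda_of_of, yoneda_of_of, yoneda_of_of,
          Ext.comp_assoc c b a rfl rfl (by lia)]
        exact of_comp_eq _ _ _ _

/-- The identity of `X`, as an element of `Ext^0(X, X) ⊆ Ext^*(X, X)`. -/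
def unit (X : A) : ExtStar.{w} X X := of X X 0 (Ext.mk₀ (𝟙 X))

lemma yoneda_unit {X Y : A} (a : ExtStar.{w} X Y) : yoneda X X Y a (unit X) = a := by
  induction a using induction_on with
  | zero => simp
  | add a a' h h' => simp [h, h']
  | of i a =>
    rw [unit, yoneda_of_of, of_comp_eq _ _ rfl (zero_add i), Ext.mk₀_id_comp]

lemma unit_yoneda {X Y : A} (a : ExtStar.{w} X Y) : yoneda X Y Y (unit Y) a = a := by
  induction a using induction_on with
  | zero => simp
  | add a a' h h' => simp [h, h']
  | of i a =>
    rw [unit, yoneda_of_of, of_comp_eq _ _ rfl (add_zero i), Ext.comp_mk₀_id]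

/-- The ring `Ext^*(X, X)`, with the Yoneda product as its multiplication. -/
instance (X : A) : Ring (ExtStar.{w} X X) where
  __ := (inferInstance : AddCommGroup (ExtStar.{w} X X))
  mul a b := yoneda X X X a b
  one := unit X
  mul_assoc a b c := yoneda_assoc a b c
  one_mul a := unit_yoneda a
  mul_one a := yoneda_unit a
  left_distrib a b c := map_add (yoneda X X X a) b c
  right_distrib a b c := DFunLike.congr_fun (map_add (yoneda X X X) a b) c
  zero_mul a := DFunLike.congr_fun (map_zero (yoneda X X X)) a
  mul_zero a := map_zero (yoneda X X X a)
  zsmul := (inferInstance : AddCommGroup (ExtStar.{w} X X)).zsmul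
  zsmul_zero' := (inferInstance : AddCommGroup (ExtStar.{w} X X)).zsmul_zero'
  zsmul_succ' := (inferInstance : AddCommGroup (ExtStar.{w} X X)).zsmul_succ'
  zsmul_neg' := (inferInstance : AddCommGroup (ExtStar.{w} X X)).zsmul_neg'
  neg_add_cancel := neg_add_cancel
  sub_eq_add_neg := sub_eq_add_neg

lemma mul_def {X : A} (a b : ExtStar.{w} X X) : a * b = yoneda X X X a b := rfl

lemma one_def (X : A) : (1 : ExtStar.{w} X X) = unit X := rfl

/-- `Ext^*(X, Y)` as a right module over `Ext^*(X, X)` by the Yoneda product, i.e. as a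
left module over the opposite ring: `op a` sends `x` to `x · a`. -/
instance (X Y : A) : Module (ExtStar.{w} X X)ᵐᵒᵖ (ExtStar.{w} X Y) where
  smul a x := yoneda X X Y x a.unop
  one_smul x := yoneda_unit x
  mul_smul a b x := (yoneda_assoc x b.unop a.unop).symm
  smul_zero a := DFunLike.congr_fun (map_zero (yoneda X X Y)) a.unop
  smul_add a x y := DFunLike.congr_fun (map_add (yoneda X X Y) x y) a.unop
  add_smul a b x := map_add (yoneda X X Y x) a.unop b.unop
  zero_smul x := map_zero (yoneda X X Y x)

lemma op_smul_def {X Y : A} (a : (ExtStar.{w} X X)ᵐᵒᵖ) (x : ExtStar.{w} X Y) :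
    a • x = yoneda X X Y x a.unop := rfl

lemma component_yoneda_eq_zero {X Y Z : A} (n : ℕ) (x : ExtStar.{w} Y Z)
    (hx : ∀ i < n, component Y Z i x = 0) (a : ExtStar.{w} X Y) (i : ℕ) (hi : i < n) :
    component X Z i (yoneda X Y Z x a) = 0 := by
  classical
  induction a using induction_on with
  | zero => simp
  | add a a' h h' => simp [h, h']
  | of k a =>
    have key : ∀ y : ExtStar.{w} Y Z, component X Z i (yoneda X Y Z y (of X Y k a)) =
        if h : k ≤ i then a.comp (component Y Z (i - k) y) (by lia) else 0 := by
      intro y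
      induction y using induction_on with
      | zero => simp
      | add y y' h h' => simp only [map_add, AddMonoidHom.add_apply, h, h']; split <;> simp
      | of j y =>
        rw [yoneda_of_of]
        split
        · by_cases hj : k + j = i
          · subst hj
            rw [component_of_same]
            obtain ⟨e, he⟩ : ∃ e, e = k + j - k := ⟨_, rfl⟩
            obtain rfl : e = j := by lia
            have : ∀ (f : ℕ) (hf : f = e) (hf' : k + f = k + e),
                a.comp (component Y Z f (of Y Z e y)) hf' = a.comp y rfl := by
              rintro f rfl hf'
              rw [component_of_same]
            exact (this _ he.symm _).symm
          · rw [component_of_ne _ _ hj, component_of_ne _ _ (by lia), Ext.comp_zero]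
        · exact component_of_ne _ _ (by lia) _
    rw [key]
    split
    · rw [hx _ (by lia), Ext.comp_zero]
    · rfl

/-- `Ext^{≥ n}(X, Y)`: the right `Ext^*(X, X)`-submodule of `Ext^*(X, Y)` of the elements
whose components in all degrees below `n` vanish. -/
def extGE (n : ℕ) (X Y : A) : Submodule (ExtStar.{w} X X)ᵐᵒᵖ (ExtStar.{w} X Y) where
  carrier := {x | ∀ i < n, component X Y i x = 0}
  zero_mem' i _ := map_zero _
  add_mem' {x y} hx hy i hi := by rw [map_add, hx i hi, hy i hi, add_zero]
  smul_mem' a x hx i hi := component_yoneda_eq_zero n x hx a.unop i hi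

lemma mem_extGE {n : ℕ} {X Y : A} (x : ExtStar.{w} X Y) :
    x ∈ extGE n X Y ↔ ∀ i < n, component X Y i x = 0 := Iff.rfl

/-- If `f : F(P_i) ⟶ D` is a cocycle on the projective resolution `F(P)` of `F(C)`, then its
adjunct `P_i ⟶ G(D)` is a cocycle on `P`. -/
lemma homEquiv_cocycle {𝒞 : Type u} [Category.{v} 𝒞] [Abelian 𝒞]
    {𝒟 : Type u'} [Category.{v'} 𝒟] [Abelian 𝒟] {F : 𝒞 ⥤ 𝒟} {G : 𝒟 ⥤ 𝒞} (adj : F ⊣ G)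
    [F.Additive] {C : 𝒞} {D : 𝒟} (P : ProjectiveResolution C) {i : ℕ}
    (f : F.obj (P.complex.X i) ⟶ D) (hf : F.map (P.complex.d (i + 1) i) ≫ f = 0) :
    P.complex.d (i + 1) i ≫ adj.homEquiv (P.complex.X i) D f = 0 := by
  have := adj.right_adjoint_additive
  rw [← adj.homEquiv_naturality_left, hf, adj.homEquiv_unit, G.map_zero, Limits.comp_zero]

end YonedaExt

end

/-! The inverse of `ψ` is the easier map to construct: send `θ` in Ext^n(C, G(D)) to the product of
the counit at `D` with `F(θ)` (`extHom`). Since the exact functor `F` respects Yoneda products,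
associativity gives (b) at once, and naturality of the counit gives functoriality in `D`.

Bijectivity is seen on a projective resolution `P` of `C`. As `F` is exact and preserves
projectives, `F(P)` resolves `F(C)`. The main technical point, `extMk_mapExactFunctor`, is that `F`
sends the class of a cocycle `f` on `P` to the class of `F(f)` on `F(P)`. Composing with the counit
yields the adjunct of `f` (`extHom_extMk`), and taking adjuncts matches cocycles with cocycles and
coboundaries with coboundaries.

For (c) and (d), the sum of these maps over all degrees is a surjection, semilinear along the ring
map Ext^*(C, C) → Ext^*(F(C), F(C)). Finite generation and the Noetherian property pass along such a
surjection. -/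

noncomputable section

/-! ### Additive functors and extension of complexes along an embedding -/

namespace HomologicalComplex

open Limits

variable {ι ι' : Type*} {c : ComplexShape ι} {c' : ComplexShape ι'}
  {C : Type*} [Category* C] [Preadditive C] [HasZeroObject C]
  {D : Type*} [Category* D] [Preadditive D] [HasZeroObject D]
  (F : C ⥤ D) [F.Additive] (K : HomologicalComplex C c) (e : c.Embedding c')

open Classical in
/-- The components of the comparison map between the extension of the image of a complex by an
additive functor and the image of its extension. -/
def extendMapComparisonF (i' : ι') :
    (((F.mapHomologicalComplex c).obj K).extend e).X i' ⟶ F.obj ((K.extend e).X i') :=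
  if h : ∃ i, e.f i = i' then
    (((F.mapHomologicalComplex c).obj K).extendXIso e h.choose_spec).hom ≫
      F.map (K.extendXIso e h.choose_spec).inv
  else 0

/-- The embedding is injective on indices, so the chosen preimage is the given one. -/
lemma extendMapComparisonF_eq {i : ι} {i' : ι'} (h : e.f i = i') :
    extendMapComparisonF F K e i' =
      (((F.mapHomologicalComplex c).obj K).extendXIso e h).hom ≫
        F.map (K.extendXIso e h).inv := by
  have h' : ∃ i, e.f i = i' := ⟨i, h⟩
  have key : ∀ (j : ι) (hj : e.f j = i'),
      (((F.mapHomologicalComplex c).obj K).extendXIso e hj).hom ≫ F.map (K.extendXIso e hj).inv =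
        (((F.mapHomologicalComplex c).obj K).extendXIso e h).hom ≫
          F.map (K.extendXIso e h).inv := by
    intro j hj
    obtain rfl : j = i := e.injective_f (hj.trans h.symm)
    rfl
  rw [extendMapComparisonF, dif_pos h']
  exact key _ _

/-- The comparison map between the extension of the image of a complex by an
additive functor and the image of its extension. -/
def extendMapComparison :
    ((F.mapHomologicalComplex c).obj K).extend e ⟶
      (F.mapHomologicalComplex c').obj (K.extend e) where
  f := extendMapComparisonF F K e
  comm' i' j' _ := by
    by_cases hi : ∃ i, e.f i = i'
    · obtain ⟨i, hi⟩ := hi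
      by_cases hj : ∃ j, e.f j = j'
      · obtain ⟨j, hj⟩ := hj
        rw [extendMapComparisonF_eq F K e hi, extendMapComparisonF_eq F K e hj,
          extend_d_eq _ e hi hj, Functor.mapHomologicalComplex_obj_d, extend_d_eq _ e hi hj]
        -- Stated for arbitrary isomorphisms, so that `simp` can cancel them; the actual objects
        -- match only up to unfolding.
        have aux {A A' : D} {B B' E E' : C} (s : A ≅ F.obj B) (s' : A' ≅ F.obj B')
            (t : E ≅ B) (t' : E' ≅ B') (d : B ⟶ B') :
            (s.hom ≫ F.map t.inv) ≫ F.map (t.hom ≫ d ≫ t'.inv) =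
              (s.hom ≫ F.map d ≫ s'.inv) ≫ s'.hom ≫ F.map t'.inv := by
          simp
        exact aux (((F.mapHomologicalComplex c).obj K).extendXIso e hi)
          (((F.mapHomologicalComplex c).obj K).extendXIso e hj) _ _ _
      · exact (F.map_isZero (K.isZero_extend_X e j' (by tauto))).eq_of_tgt _ _
    · exact (isZero_extend_X _ e i' (by tauto)).eq_of_src _ _

lemma extendMapComparison_f {i : ι} {i' : ι'} (h : e.f i = i') :
    (extendMapComparison F K e).f i' =
      (((F.mapHomologicalComplex c).obj K).extendXIso e h).hom ≫
        F.map (K.extendXIso e h).inv :=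
  extendMapComparisonF_eq F K e h

end HomologicalComplex

/-! ### Shifted morphisms under functors -/

namespace CochainComplex.HomComplex

variable {C : Type*} [Category* C] [Preadditive C] {D : Type*} [Category* D] [Preadditive D]
  (F : C ⥤ D) [F.Additive]

lemma Cocycle.equivHomShift_map {K L : CochainComplex C ℤ} {n : ℤ} (g : K ⟶ L⟦n⟧) (p q : ℤ)
    (hpq : p + n = q) :
    (equivHomShift (ShiftedHom.map g (F.mapHomologicalComplex (ComplexShape.up ℤ)))).1.v p q hpq =
      F.map ((equivHomShift g).1.v p q hpq) := by
  subst hpq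
  simp [equivHomShift_apply, Cochain.rightUnshift_v _ _ _ _ _ _ _ (add_zero p), ShiftedHom.map]
  erw [Category.comp_id, Category.comp_id]

end CochainComplex.HomComplex

namespace CategoryTheory.ShiftedHom

/-- Intended for localization functors `Q`, `Q'`, a functor `T` on complexes and its derived functor
`T'`. By `h`, the shifted morphism `e` is represented by `z` after composing with `p`; compatibility
of `φ` with shifts carries this representation over to the image of `e` under `T'`. -/
lemma map_comp_map_of_natIso {M : Type*} [AddMonoid M]
    {A B A' B' : Type*} [Category* A] [Category* B] [Category* A'] [Category* B']
    [HasShift A M] [HasShift B M] [HasShift A' M] [HasShift B' M]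
    {Q : A ⥤ A'} {Q' : B ⥤ B'} {T : A ⥤ B} {T' : A' ⥤ B'}
    [Q.CommShift M] [Q'.CommShift M] [T.CommShift M] [T'.CommShift M]
    (φ : Q ⋙ T' ≅ T ⋙ Q') [NatTrans.CommShift φ.hom M]
    {X Y K : A} {X' Y' : A'} {U V K' : B} {U' V' : B'}
    (iX : X' ≅ Q.obj X) (iY : Y' ≅ Q.obj Y) (tX : T.obj X ≅ U) (tY : T.obj Y ≅ V)
    (mX : T'.obj X' ≅ U') (mY : T'.obj Y' ≅ V') (jX : U' ≅ Q'.obj U) (jY : V' ≅ Q'.obj V)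
    (hX : mX.hom ≫ jX.hom = T'.map iX.hom ≫ φ.hom.app X ≫ Q'.map tX.hom)
    (hY : mY.hom ≫ jY.hom = T'.map iY.hom ≫ φ.hom.app Y ≫ Q'.map tY.hom) {n : M}
    (p : K ⟶ X) (e : ShiftedHom X' Y' n) (z : ShiftedHom K Y n)
    (h : Q.map p ≫ iX.inv ≫ e ≫ iY.hom⟦n⟧' = ShiftedHom.map z Q) (α : K' ⟶ T.obj K) :
    Q'.map (α ≫ T.map p ≫ tX.hom) ≫ jX.inv ≫
      (mX.inv ≫ e.map T' ≫ mY.hom⟦n⟧') ≫ jY.hom⟦n⟧' =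
    ShiftedHom.map (α ≫ z.map T ≫ tY.hom⟦n⟧' : ShiftedHom _ _ n) Q' := by
  have hX' : jX.inv ≫ mX.inv = Q'.map tX.inv ≫ φ.inv.app X ≫ T'.map iX.inv := by
    have := congrArg Iso.inv (Iso.ext hX : mX ≪≫ jX = T'.mapIso iX ≪≫ φ.app X ≪≫ Q'.mapIso tX)
    simpa using this
  have hφ : Q'.map (T.map p) ≫ φ.inv.app X = φ.inv.app K ≫ T'.map (Q.map p) :=
    φ.inv.naturality p
  have hz := map_naturality z φ.hom
  rw [comp_mk₀, mk₀_comp] at hz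
  have hz' : (ShiftedHom.map z Q).map T' ≫ (φ.hom.app Y)⟦n⟧' =
      φ.hom.app K ≫ (z.map T).map Q' := by
    rw [← comp_map, ← comp_map]
    exact hz
  have h' : T'.map (Q.map p) ≫ T'.map iX.inv ≫ e.map T' ≫ (T'.map iY.hom)⟦n⟧' =
      (ShiftedHom.map z Q).map T' := by
    rw [← h]
    simp [ShiftedHom.map]
  have hmap : ShiftedHom.map (α ≫ z.map T ≫ tY.hom⟦n⟧' : ShiftedHom _ _ n) Q' =
      Q'.map α ≫ (z.map T).map Q' ≫ (Q'.map tY.hom)⟦n⟧' := by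
    simp [ShiftedHom.map]
  calc
    _ = Q'.map α ≫ Q'.map (T.map p) ≫ Q'.map tX.hom ≫ (jX.inv ≫ mX.inv) ≫ e.map T' ≫
        (mY.hom ≫ jY.hom)⟦n⟧' := by
      simp only [Functor.map_comp, Category.assoc]
    _ = Q'.map α ≫ (Q'.map (T.map p) ≫ φ.inv.app X) ≫ T'.map iX.inv ≫ e.map T' ≫
        (T'.map iY.hom)⟦n⟧' ≫ (φ.hom.app Y)⟦n⟧' ≫ (Q'.map tY.hom)⟦n⟧' := by
      rw [hX', hY]
      simp only [Functor.map_comp, Category.assoc, Iso.map_hom_inv_id_assoc]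
    _ = Q'.map α ≫ φ.inv.app K ≫ (T'.map (Q.map p) ≫ T'.map iX.inv ≫ e.map T' ≫
        (T'.map iY.hom)⟦n⟧') ≫ (φ.hom.app Y)⟦n⟧' ≫ (Q'.map tY.hom)⟦n⟧' := by
      rw [hφ]
      simp only [Category.assoc]
    _ = Q'.map α ≫ φ.inv.app K ≫ ((ShiftedHom.map z Q).map T' ≫ (φ.hom.app Y)⟦n⟧') ≫
          (Q'.map tY.hom)⟦n⟧' := by
      rw [h']
      simp only [Category.assoc]
    _ = _ := by
      rw [hz', hmap, Category.assoc, Iso.inv_hom_id_app_assoc]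

end CategoryTheory.ShiftedHom

/-! ### Exact functors and Ext classes of cocycles -/

namespace CategoryTheory.ProjectiveResolution

open Limits CochainComplex.HomComplex

variable {C : Type u} [Category.{v} C] [Abelian C] {D : Type u'} [Category.{v'} D] [Abelian D]
  (F : C ⥤ D) [F.Additive] [PreservesFiniteLimits F] [PreservesFiniteColimits F]
  {X Y : C} (R : ProjectiveResolution X)

open _root_.DerivedCategory in
-- The class of a cocycle is the inverse of the augmentation followed by the cocycle, viewed as a
-- map of complexes into a shifted single complex. Composing with the augmentation removes the
-- inverse.
lemma map_π'_comp_extMk_hom [HasExt.{w} C] [HasDerivedCategory C] {n : ℕ}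
    (f : R.complex.X n ⟶ Y) (m : ℕ) (hm : n + 1 = m) (hf : R.complex.d m n ≫ f = 0) :
    Q.map R.π' ≫ (singleFunctorIsoCompQ C 0).inv.app X ≫ (R.extMk f m hm hf).hom ≫
      ((singleFunctorIsoCompQ C 0).hom.app Y)⟦(n : ℤ)⟧' =
    ShiftedHom.map (Cocycle.equivHomShift.symm
      (Cocycle.toSingleMk ((R.cochainComplexXIso (-n) n rfl).hom ≫ f) (by simp) (-m)
        (by lia) (by simpa [cochainComplex_d _ _ _ _ _ rfl rfl])) : ShiftedHom _ _ (n : ℤ)) Q := by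
  rw [extMk_hom, ShiftedHom.mk₀_comp, ShiftedHom.comp_mk₀]
  simp only [Category.assoc, Iso.inv_hom_id_app_assoc, IsIso.hom_inv_id_assoc, ← Functor.map_comp,
    Iso.inv_hom_id_app]
  erw [Functor.map_id]
  exact Category.comp_id _

open _root_.DerivedCategory in
lemma mapDerivedCategorySingleFunctor_hom_comp_singleFunctorIsoCompQ_hom
    [HasDerivedCategory C] [HasDerivedCategory D] (Y : C) :
    ((F.mapDerivedCategorySingleFunctor 0).app Y).hom ≫
      ((singleFunctorIsoCompQ D 0).app (F.obj Y)).hom =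
    F.mapDerivedCategory.map ((singleFunctorIsoCompQ C 0).app Y).hom ≫
      F.mapDerivedCategoryFactors.hom.app _ ≫
        Q.map ((F.mapCochainComplexSingleFunctor 0).app Y).hom := by
  have aux {X₀ X₁ X₂ X₃ X₄ : DerivedCategory D} (a : X₀ ⟶ X₁) (b : X₁ ⟶ X₂)
      (c : X₂ ⟶ X₃) (d : X₄ ≅ X₃) :
      (a ≫ 𝟙 _ ≫ b ≫ 𝟙 _ ≫ c ≫ 𝟙 _ ≫ d.inv) ≫ d.hom = a ≫ b ≫ c := by
    simp
  exact aux _ _ _ ((singleFunctorIsoCompQ D 0).app (F.obj Y))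

open _root_.DerivedCategory in
lemma map_comp_mapDerivedCategory_of_map_comp
    [HasDerivedCategory C] [HasDerivedCategory D] {K : CochainComplex C ℤ} {n : ℤ}
    (p : K ⟶ (CochainComplex.singleFunctor C 0).obj X)
    (e : ShiftedHom ((singleFunctor C 0).obj X) ((singleFunctor C 0).obj Y) n)
    (z : ShiftedHom K ((CochainComplex.singleFunctor C 0).obj Y) n)
    (h : Q.map p ≫ (singleFunctorIsoCompQ C 0).inv.app X ≫ e ≫
      ((singleFunctorIsoCompQ C 0).hom.app Y)⟦n⟧' = ShiftedHom.map z Q)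
    {K' : CochainComplex D ℤ} (α : K' ⟶ (F.mapHomologicalComplex (.up ℤ)).obj K) :
    Q.map (α ≫ (F.mapHomologicalComplex (.up ℤ)).map p ≫
        (F.mapCochainComplexSingleFunctor 0).hom.app X) ≫
      (singleFunctorIsoCompQ D 0).inv.app (F.obj X) ≫
      ((F.mapDerivedCategorySingleFunctor 0).inv.app X ≫ e.map F.mapDerivedCategory ≫
        ((F.mapDerivedCategorySingleFunctor 0).hom.app Y)⟦n⟧') ≫
      ((singleFunctorIsoCompQ D 0).hom.app (F.obj Y))⟦n⟧' =
    ShiftedHom.map (α ≫ z.map (F.mapHomologicalComplex (.up ℤ)) ≫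
      ((F.mapCochainComplexSingleFunctor 0).hom.app Y)⟦n⟧' : ShiftedHom _ _ n) Q := by
  exact ShiftedHom.map_comp_map_of_natIso F.mapDerivedCategoryFactors
    ((singleFunctorIsoCompQ C 0).app X) ((singleFunctorIsoCompQ C 0).app Y)
    ((F.mapCochainComplexSingleFunctor 0).app X) ((F.mapCochainComplexSingleFunctor 0).app Y)
    ((F.mapDerivedCategorySingleFunctor 0).app X) ((F.mapDerivedCategorySingleFunctor 0).app Y)
    ((singleFunctorIsoCompQ D 0).app (F.obj X)) ((singleFunctorIsoCompQ D 0).app (F.obj Y))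
    (mapDerivedCategorySingleFunctor_hom_comp_singleFunctorIsoCompQ_hom F X)
    (mapDerivedCategorySingleFunctor_hom_comp_singleFunctorIsoCompQ_hom F Y) p e z h α

variable [F.PreservesProjectiveObjects]

/-- The comparison map between the cochain complexes attached to the image of a projective
resolution and the image of the attached cochain complex. -/
def mapCochainComplexComparison :
    (F.mapProjectiveResolution R).cochainComplex ⟶
      (F.mapHomologicalComplex (ComplexShape.up ℤ)).obj R.cochainComplex :=
  HomologicalComplex.extendMapComparison F R.complex ComplexShape.embeddingDownNat

lemma mapCochainComplexComparison_f (i' : ℤ) (i : ℕ) (h : -i = i') :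
    (R.mapCochainComplexComparison F).f i' =
      ((F.mapProjectiveResolution R).cochainComplexXIso i' i h).hom ≫
        F.map (R.cochainComplexXIso i' i h).inv :=
  HomologicalComplex.extendMapComparison_f F R.complex ComplexShape.embeddingDownNat h

/-- The target is concentrated in degree 0, so only that component has to be compared. -/
lemma mapCochainComplexComparison_comp_π' :
    R.mapCochainComplexComparison F ≫ (F.mapHomologicalComplex (ComplexShape.up ℤ)).map R.π' ≫
      (F.mapCochainComplexSingleFunctor 0).hom.app X = (F.mapProjectiveResolution R).π' := by
  refine HomologicalComplex.to_single_hom_ext ?_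
  rw [HomologicalComplex.comp_f, HomologicalComplex.comp_f,
    mapCochainComplexComparison_f F R 0 0 rfl, π'_f_zero]
  simp only [π'_f_zero, Functor.mapHomologicalComplex_map_f,
    Functor.mapCochainComplexSingleFunctor,
    HomologicalComplex.singleMapHomologicalComplex_hom_app_self]
  have aux {A : D} {B B' E E' : C} {A' : D} (s : A ≅ F.obj B) (t : E ≅ B) (p : B ⟶ B')
      (u : E' ≅ B') (z : A' ≅ F.obj B') :
      (s.hom ≫ F.map t.inv) ≫ F.map (t.hom ≫ p ≫ u.inv) ≫ F.map u.hom ≫ z.inv =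
        s.hom ≫ (F.map p ≫ 𝟙 _) ≫ z.inv := by
    simp
  refine (aux ((F.mapProjectiveResolution R).cochainComplexXIso 0 0) _ (R.π.f 0) _ _).trans ?_
  congr 2

lemma mapProjectiveResolution_d_comp_eq_zero {n m : ℕ} (f : R.complex.X n ⟶ Y)
    (hf : R.complex.d m n ≫ f = 0) :
    (F.mapProjectiveResolution R).complex.d m n ≫ F.map f = 0 := by
  change F.map _ ≫ F.map f = 0
  rw [← F.map_comp, hf, F.map_zero]

/-- A cocycle into a single complex is determined by one component, which reduces the claim to
degree `-n`. The map `g` is kept apart from `F.map f` because their sources agree only by unfolding.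
-/
lemma comparison_comp_map_toSingleMk {n : ℕ} (f : R.complex.X n ⟶ Y) (m : ℕ) (hm : n + 1 = m)
    (hf : R.complex.d m n ≫ f = 0)
    (g : (F.mapProjectiveResolution R).complex.X n ⟶ F.obj Y)
    (hg : (F.mapProjectiveResolution R).complex.d m n ≫ g = 0) (hfg : g = F.map f) :
    R.mapCochainComplexComparison F ≫
      ShiftedHom.map (Cocycle.equivHomShift.symm
          (Cocycle.toSingleMk ((R.cochainComplexXIso (-n) n rfl).hom ≫ f) (by simp) (-m)
            (by lia) (by simpa [cochainComplex_d _ _ _ _ _ rfl rfl])) : ShiftedHom _ _ (n : ℤ))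
        (F.mapHomologicalComplex (ComplexShape.up ℤ)) ≫
      ((F.mapCochainComplexSingleFunctor 0).hom.app Y)⟦(n : ℤ)⟧' =
    Cocycle.equivHomShift.symm
      (Cocycle.toSingleMk (((F.mapProjectiveResolution R).cochainComplexXIso (-n) n rfl).hom ≫
        g) (by simp) (-m) (by lia) (by
          simpa [cochainComplex_d _ _ _ _ _ rfl rfl])) := by
  apply Cocycle.equivHomShift.injective
  ext : 1
  apply (Cochain.toSingleEquiv (p := -(n : ℤ)) (q := 0) (n := n) (by simp)).injective
  erw [Cocycle.equivHomShift_comp, Cocycle.equivHomShift_comp_shift]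
  simp only [AddEquiv.apply_symm_apply, Cocycle.toSingleMk_coe, Cochain.toSingleEquiv_toSingleMk]
  simp only [Cochain.toSingleEquiv, AddEquiv.coe_mk, Equiv.coe_fn_mk, Cocycle.precomp_coe,
    Cocycle.postcomp_coe, Cochain.zero_cochain_comp_v, Cochain.comp_zero_cochain_v,
    Cochain.ofHom_v]
  rw [mapCochainComplexComparison_f F R _ n rfl, Cocycle.equivHomShift_map]
  simp only [AddEquiv.apply_symm_apply, Cocycle.toSingleMk_coe, Cochain.toSingleMk_v,
    Functor.mapCochainComplexSingleFunctor]
  have aux {A : D} {B B' E E' : C} {A' : D} (s : A ≅ F.obj B) (t : E ≅ B) (p : B ⟶ B')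
      (u : E' ≅ B') (z : A' ≅ F.obj B') :
      ((s.hom ≫ F.map t.inv) ≫ F.map ((t.hom ≫ p) ≫ u.inv) ≫ F.map u.hom ≫ z.inv) ≫ z.hom =
        s.hom ≫ F.map p := by
    simp
  subst hfg
  refine Eq.trans ?_ (aux ((F.mapProjectiveResolution R).cochainComplexXIso (-n) n rfl)
    (R.cochainComplexXIso (-n) n rfl) f (HomologicalComplex.singleObjXSelf (.up ℤ) 0 Y)
    (HomologicalComplex.singleObjXSelf (.up ℤ) 0 (F.obj Y)))
  congr 3
  exact HomologicalComplex.singleMapHomologicalComplex_hom_app_self F (.up ℤ) 0 Y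

open _root_.DerivedCategory in
lemma extMk_mapExactFunctor_of_eq [HasExt.{w} C] [HasExt.{w'} D] {n : ℕ}
    (f : R.complex.X n ⟶ Y) (m : ℕ) (hm : n + 1 = m) (hf : R.complex.d m n ≫ f = 0)
    (g : (F.mapProjectiveResolution R).complex.X n ⟶ F.obj Y)
    (hg : (F.mapProjectiveResolution R).complex.d m n ≫ g = 0) (hfg : g = F.map f) :
    (R.extMk f m hm hf).mapExactFunctor F = (F.mapProjectiveResolution R).extMk g m hm hg := by
  have := HasDerivedCategory.standard C
  have := HasDerivedCategory.standard D
  ext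
  -- The augmentation of the resolution of `F(X)` becomes invertible in the derived category, so it
  -- may be cancelled; both sides then come from maps of complexes.
  rw [← cancel_mono (((singleFunctorIsoCompQ D 0).hom.app (F.obj Y))⟦(n : ℤ)⟧'),
    ← cancel_epi ((singleFunctorIsoCompQ D 0).inv.app (F.obj X)),
    ← cancel_epi (Q.map (F.mapProjectiveResolution R).π'), map_π'_comp_extMk_hom,
    ← comparison_comp_map_toSingleMk F R f m hm hf g hg hfg,
    ← mapCochainComplexComparison_comp_π', Ext.mapExactFunctor_hom]
  exact map_comp_mapDerivedCategory_of_map_comp F _ _ _ (map_π'_comp_extMk_hom R f m hm hf) _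

lemma extMk_mapExactFunctor [HasExt.{w} C] [HasExt.{w'} D] {n : ℕ}
    (f : R.complex.X n ⟶ Y) (m : ℕ) (hm : n + 1 = m) (hf : R.complex.d m n ≫ f = 0) :
    (R.extMk f m hm hf).mapExactFunctor F =
      (F.mapProjectiveResolution R).extMk (F.map f) m hm
        (mapProjectiveResolution_d_comp_eq_zero F R f hf) :=
  extMk_mapExactFunctor_of_eq F R f m hm hf _ _ rfl

end CategoryTheory.ProjectiveResolution

/-! ### The adjunction isomorphism on Ext -/

namespace CategoryTheory.Adjunction

open Limits

variable {C : Type u} [Category.{v} C] [Abelian C] [HasExt.{w} C]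
  {D : Type u'} [Category.{v'} D] [Abelian D] [HasExt.{w'} D]
  {F : C ⥤ D} {G : D ⥤ C} (adj : F ⊣ G)
  [F.Additive] [PreservesFiniteLimits F] [PreservesFiniteColimits F]

/-- The map `Ext^n(X, G(Y)) → Ext^n(F(X), Y)` given by applying the exact functor `F` and composing
with the counit of the adjunction. -/
def extHom (n : ℕ) (X : C) (Y : D) : Ext.{w} X (G.obj Y) n →+ Ext.{w'} (F.obj X) Y n :=
  ((Ext.bilinearComp (F.obj X) (F.obj (G.obj Y)) Y n 0 n (add_zero n)).flip
    (Ext.mk₀ (adj.counit.app Y))).comp (F.mapExtAddHom X (G.obj Y) n)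

lemma extHom_apply {n : ℕ} {X : C} {Y : D} (θ : Ext.{w} X (G.obj Y) n) :
    adj.extHom n X Y θ =
      (θ.mapExactFunctor F).comp (Ext.mk₀ (adj.counit.app Y)) (add_zero n) := rfl

lemma extHom_mk₀ {X : C} {Y : D} (f : X ⟶ G.obj Y) :
    adj.extHom 0 X Y (Ext.mk₀ f) = Ext.mk₀ ((adj.homEquiv X Y).symm f) := by
  rw [extHom_apply, Ext.mapExactFunctor_mk₀, Ext.mk₀_comp_mk₀, adj.homEquiv_counit]

lemma extHom_comp {m n p : ℕ} {X X' : C} {Y : D} (η : Ext.{w} X' X m)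
    (θ : Ext.{w} X (G.obj Y) n) (h : m + n = p) :
    adj.extHom p X' Y (η.comp θ h) = (η.mapExactFunctor F).comp (adj.extHom n X Y θ) h := by
  rw [extHom_apply, extHom_apply, Ext.mapExactFunctor_comp,
    Ext.comp_assoc _ _ _ h (add_zero n) (by lia)]

lemma extHom_comp_mk₀ {n : ℕ} {X : C} {Y Y' : D} (θ : Ext.{w} X (G.obj Y) n) (g : Y ⟶ Y') :
    adj.extHom n X Y' (θ.comp (Ext.mk₀ (G.map g)) (add_zero n)) =
      (adj.extHom n X Y θ).comp (Ext.mk₀ g) (add_zero n) := by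
  rw [extHom_apply, extHom_apply, Ext.mapExactFunctor_comp, Ext.mapExactFunctor_mk₀,
    Ext.comp_assoc _ _ _ (add_zero n) (add_zero 0) (by lia),
    Ext.comp_assoc _ _ _ (add_zero n) (add_zero 0) (by lia), Ext.mk₀_comp_mk₀, Ext.mk₀_comp_mk₀]
  congr 2
  exact adj.counit_naturality g

variable [F.PreservesProjectiveObjects]

/-- The functor gives the class of `F.map f`, and following it by the counit gives the adjunct `g`.
-/
lemma extHom_extMk {X : C} {Y : D} (P : ProjectiveResolution X) {n : ℕ}
    (f : P.complex.X n ⟶ G.obj Y) (m : ℕ) (hm : n + 1 = m) (hf : P.complex.d m n ≫ f = 0)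
    (g : F.obj (P.complex.X n) ⟶ Y) (hg : F.map (P.complex.d m n) ≫ g = 0)
    (hfg : adj.homEquiv _ _ g = f) :
    adj.extHom n X Y (P.extMk f m hm hf) = (F.mapProjectiveResolution P).extMk g m hm hg := by
  rw [extHom_apply, ProjectiveResolution.extMk_mapExactFunctor]
  refine ((F.mapProjectiveResolution P).extMk_comp_mk₀ _ _ hm _ _).trans ?_
  congr 1
  rw [← hfg]
  exact (adj.homEquiv_counit _ _ _).symm.trans (Equiv.symm_apply_apply _ _)

/-- By naturality, adjunction commutes with precomposition by the differentials and preserves zero.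
It therefore identifies the cocycles and coboundaries computing the two Ext groups. -/
lemma extHom_bijective [EnoughProjectives C] (n : ℕ) (X : C) (Y : D) :
    Function.Bijective (adj.extHom n X Y) := by
  obtain _ | n := n
  -- Degree 0 is separate: the coboundary criterion used below needs a preceding degree.
  · have h : adj.extHom 0 X Y ∘ Ext.mk₀ = Ext.mk₀ ∘ (adj.homEquiv X Y).symm :=
      funext fun f => adj.extHom_mk₀ f
    rw [← Function.Bijective.of_comp_iff _ (Ext.mk₀_bijective X (G.obj Y)), h]
    exact (Ext.mk₀_bijective _ _).comp (adj.homEquiv X Y).symm.bijective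
  have P : ProjectiveResolution X := .of X
  have hd (k : ℕ) {l : ℕ} (g : F.obj (P.complex.X l) ⟶ Y) :
      P.complex.d k l ≫ adj.homEquiv _ _ g = adj.homEquiv _ _ (F.map (P.complex.d k l) ≫ g) :=
    (adj.homEquiv_naturality_left _ _).symm
  have := adj.right_adjoint_additive
  have h0 (X : C) : adj.homEquiv X Y 0 = 0 := by simp [adj.homEquiv_unit]
  constructor
  · rw [injective_iff_map_eq_zero]
    intro θ hθ
    obtain ⟨f, hf, rfl⟩ := P.extMk_surjective θ (n + 2) rfl
    obtain ⟨g, rfl⟩ := (adj.homEquiv _ _).surjective f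
    have hg : F.map (P.complex.d (n + 2) (n + 1)) ≫ g = 0 := by
      rw [hd, ← h0] at hf
      exact (adj.homEquiv _ _).injective hf
    rw [adj.extHom_extMk P _ (n + 2) rfl hf g hg rfl] at hθ
    obtain ⟨g', hg'⟩ :=
      ((F.mapProjectiveResolution P).extMk_eq_zero_iff _ _ rfl hg n rfl).1 hθ
    exact (P.extMk_eq_zero_iff _ _ rfl hf n rfl).2
      ⟨adj.homEquiv _ _ g', (hd _ _).trans (congrArg _ hg')⟩
  · intro θ
    obtain ⟨g, hg, rfl⟩ := (F.mapProjectiveResolution P).extMk_surjective θ (n + 2) rfl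
    exact ⟨P.extMk (adj.homEquiv _ _ g) (n + 2) rfl
      ((hd _ _).trans ((congrArg _ hg).trans (h0 _))), adj.extHom_extMk P _ _ _ _ g hg rfl⟩

/-- The isomorphism `Ext^n(F(X), Y) ≃ Ext^n(X, G(Y))` induced by an adjunction `F ⊣ G` when `F` is
exact and preserves projective objects. -/
def extEquiv [EnoughProjectives C] (n : ℕ) (X : C) (Y : D) :
    Ext.{w'} (F.obj X) Y n ≃+ Ext.{w} X (G.obj Y) n :=
  (AddEquiv.ofBijective (adj.extHom n X Y) (adj.extHom_bijective n X Y)).symm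

lemma extEquiv_symm_apply [EnoughProjectives C] {n : ℕ} {X : C} {Y : D}
    (θ : Ext.{w} X (G.obj Y) n) : (adj.extEquiv n X Y).symm θ = adj.extHom n X Y θ := rfl

lemma extHom_extEquiv [EnoughProjectives C] {n : ℕ} {X : C} {Y : D}
    (x : Ext.{w'} (F.obj X) Y n) : adj.extHom n X Y (adj.extEquiv.{w} n X Y x) = x :=
  (adj.extEquiv n X Y).symm_apply_apply x

end CategoryTheory.Adjunction

/-! ### Induced maps on total Ext -/

namespace YonedaExt

open Limits

variable {A : Type u} [Category.{v} A] [Abelian A] [HasExt.{w} A]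
  {B : Type u'} [Category.{v'} B] [Abelian B] [HasExt.{w'} B]
  (F : A ⥤ B) [F.Additive] [PreservesFiniteLimits F] [PreservesFiniteColimits F]

/-- The map `Ext^*(X, Y) → Ext^*(F(X), F(Y))` induced by an exact functor `F`. -/
def mapExact (X Y : A) : ExtStar.{w} X Y →+ ExtStar.{w'} (F.obj X) (F.obj Y) :=
  lift fun n => (of (F.obj X) (F.obj Y) n).comp (F.mapExtAddHom X Y n)

lemma mapExact_of {X Y : A} {n : ℕ} (a : Ext.{w} X Y n) :
    mapExact.{w, w'} F X Y (of X Y n a) = of _ _ n (a.mapExactFunctor F) :=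
  lift_of _ _ _

lemma mapExact_yoneda {X Y Z : A} (a : ExtStar.{w} Y Z) (b : ExtStar.{w} X Y) :
    mapExact.{w, w'} F X Z (yoneda X Y Z a b) =
      yoneda _ _ _ (mapExact F Y Z a) (mapExact F X Y b) := by
  induction a using induction_on with
  | zero => simp
  | add a a' h h' => simp only [map_add, AddMonoidHom.add_apply, h, h']
  | of i a =>
    induction b using induction_on with
    | zero => simp
    | add b b' h h' => simp only [map_add, h, h']
    | of j b => rw [yoneda_of_of, mapExact_of, mapExact_of, mapExact_of, yoneda_of_of,
        Ext.mapExactFunctor_comp]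

lemma mapExact_unit (X : A) : mapExact.{w, w'} F X X (unit X) = unit (F.obj X) := by
  rw [unit, mapExact_of, Ext.mapExactFunctor_mk₀, F.map_id, unit]

/-- The ring homomorphism `Ext^*(X, X) → Ext^*(F(X), F(X))` induced by an exact functor `F`. -/
def mapRingHom (X : A) : ExtStar.{w} X X →+* ExtStar.{w'} (F.obj X) (F.obj X) where
  toFun := mapExact F X X
  map_one' := mapExact_unit F X
  map_mul' := mapExact_yoneda F
  map_zero' := map_zero (mapExact F X X)
  map_add' := map_add (mapExact F X X)

variable {F} {G : B ⥤ A} (adj : F ⊣ G)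

/-- The map `Ext^*(X, G(Y)) → Ext^*(F(X), Y)` induced by an adjunction `F ⊣ G` where `F` is
exact. -/
def adjAddHom (X : A) (Y : B) : ExtStar.{w} X (G.obj Y) →+ ExtStar.{w'} (F.obj X) Y :=
  lift fun n => (of (F.obj X) Y n).comp (adj.extHom n X Y)

lemma adjAddHom_of {X : A} {Y : B} {n : ℕ} (a : Ext.{w} X (G.obj Y) n) :
    adjAddHom.{w, w'} adj X Y (of X _ n a) = of _ _ n (adj.extHom n X Y a) :=
  lift_of _ _ _

lemma adjAddHom_yoneda {X X' : A} {Y : B} (x : ExtStar.{w} X (G.obj Y)) (a : ExtStar.{w} X' X) :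
    adjAddHom.{w, w'} adj X' Y (yoneda _ _ _ x a) =
      yoneda _ _ _ (adjAddHom adj X Y x) (mapExact F X' X a) := by
  induction a using induction_on with
  | zero => simp
  | add a a' h h' => simp only [map_add, h, h']
  | of i a =>
    induction x using induction_on with
    | zero => simp
    | add b b' h h' => simp only [map_add, AddMonoidHom.add_apply, h, h']
    | of j b => rw [yoneda_of_of, adjAddHom_of, adjAddHom_of, mapExact_of, yoneda_of_of,
        adj.extHom_comp]

lemma component_adjAddHom {X : A} {Y : B} (n : ℕ) (x : ExtStar.{w} X (G.obj Y)) :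
    component _ _ n (adjAddHom.{w, w'} adj X Y x) = adj.extHom n X Y (component _ _ n x) := by
  induction x using induction_on with
  | zero => simp
  | add a a' h h' => simp [h, h']
  | of i a =>
    rw [adjAddHom_of]
    by_cases h : i = n
    · subst h
      rw [component_of_same, component_of_same]
    · rw [component_of_ne _ _ h, component_of_ne _ _ h, map_zero]

/-- `YonedaExt.adjAddHom` as a map which is semilinear over `YonedaExt.mapRingHom`. -/
def adjHom (X : A) (Y : B) :
    ExtStar.{w} X (G.obj Y) →ₛₗ[(mapRingHom.{w, w'} F X).op] ExtStar.{w'} (F.obj X) Y where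
  toFun := adjAddHom adj X Y
  map_add' := map_add (adjAddHom adj X Y)
  map_smul' a x := adjAddHom_yoneda adj x a.unop

variable [F.PreservesProjectiveObjects] [EnoughProjectives A]

lemma adjHom_surjective (X : A) (Y : B) : Function.Surjective (adjHom.{w, w'} adj X Y) := by
  intro y
  induction y using induction_on with
  | zero => exact ⟨0, map_zero _⟩
  | add a b ha hb =>
    obtain ⟨a, rfl⟩ := ha
    obtain ⟨b, rfl⟩ := hb
    exact ⟨a + b, map_add _ _ _⟩
  | of n y =>
    obtain ⟨x, rfl⟩ := (adj.extHom_bijective.{w, w'} n X Y).2 y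
    exact ⟨of _ _ n x, adjAddHom_of adj x⟩

/-- The map acts degreewise and is injective in each degree, so a component vanishes exactly when
its image does. -/
lemma adjHom_mem_extGE_iff {X : A} {Y : B} {n : ℕ} (x : ExtStar.{w} X (G.obj Y)) :
    adjHom.{w, w'} adj X Y x ∈ extGE n (F.obj X) Y ↔ x ∈ extGE n X (G.obj Y) := by
  change (∀ i < n, component _ _ i (adjAddHom adj X Y x) = 0) ↔ ∀ i < n, component _ _ i x = 0
  simp only [component_adjAddHom, map_eq_zero_iff _ (adj.extHom_bijective.{w, w'} _ X Y).1]

end YonedaExt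

/-! ### Finiteness along semilinear surjections -/

section Semilinear

variable {R S M N : Type*} [Ring R] [Ring S] [AddCommGroup M] [AddCommGroup N]
  [Module R M] [Module S N] {σ : R →+* S} (f : M →ₛₗ[σ] N) (hf : Function.Surjective f)

include hf

/-- Images of generators of the preimage generate `p`: the preimage of their `S`-span is an
`R`-submodule containing the original generators. -/
lemma Submodule.fg_of_fg_comap_of_surjective (p : Submodule S N) (h : (p.comap f).FG) : p.FG := by
  obtain ⟨s, hs⟩ := h
  classical
  refine ⟨s.image f, le_antisymm ?_ ?_⟩
  · rw [Submodule.span_le, Finset.coe_image, Set.image_subset_iff]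
    exact fun x hx => Submodule.mem_comap.1 (hs ▸ Submodule.subset_span hx)
  · intro y hy
    obtain ⟨x, rfl⟩ := hf y
    have hle : Submodule.span R s ≤ (Submodule.span S (s.image f : Set N)).comap f := by
      rw [Submodule.span_le]
      exact fun x hx => Submodule.subset_span (Finset.mem_coe.2 (Finset.mem_image_of_mem f hx))
    exact hle (hs ▸ hy)

lemma IsNoetherian.of_surjective_semilinear [IsNoetherian R M] : IsNoetherian S N :=
  ⟨fun p => Submodule.fg_of_fg_comap_of_surjective f hf p (IsNoetherian.noetherian _)⟩

end Semilinear

end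

/-! ### The theorem -/

theorem mainTheorem5
    {𝒞 : Type u} [Category.{v} 𝒞] [Abelian 𝒞] [EnoughProjectives 𝒞] [EnoughInjectives 𝒞]
    [HasExt.{w} 𝒞]
    {𝒟 : Type u'} [Category.{v'} 𝒟] [Abelian 𝒟] [EnoughProjectives 𝒟] [EnoughInjectives 𝒟]
    [HasExt.{w'} 𝒟]
    (F : 𝒞 ⥤ 𝒟) (G : 𝒟 ⥤ 𝒞) (adj : F ⊣ G)
    [F.Additive] [Limits.PreservesFiniteLimits F] [Limits.PreservesFiniteColimits F]
    [F.PreservesProjectiveObjects] :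
    -- (a) and (b)
    (∃ ψ : ∀ (i : ℕ) (C : 𝒞) (D : 𝒟), Ext.{w'} (F.obj C) D i ≃+ Ext.{w} C (G.obj D) i,
      -- in degree zero, `ψ` is the adjunction
      (∀ (C : 𝒞) (D : 𝒟) (f : F.obj C ⟶ D),
        ψ 0 C D (Ext.mk₀ f) = Ext.mk₀ (adj.homEquiv C D f)) ∧
      -- `ψ` is induced by the adjunction on projective resolutions
      (∀ (C : 𝒞) (D : 𝒟) (P : ProjectiveResolution C) (i : ℕ)
        (f : F.obj (P.complex.X i) ⟶ D)
        (hf : F.map (P.complex.d (i + 1) i) ≫ f = 0),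
        ψ i C D ((F.mapProjectiveResolution P).extMk f (i + 1) rfl hf) =
          P.extMk (adj.homEquiv (P.complex.X i) D f) (i + 1) rfl
            (YonedaExt.homEquiv_cocycle adj P f hf)) ∧
      -- `ψ` is functorial in both variables
      (∀ (i : ℕ) (C C' : 𝒞) (D D' : 𝒟) (f : C' ⟶ C) (g : D ⟶ D')
        (x : Ext.{w'} (F.obj C) D i),
        ψ i C' D' (((Ext.mk₀ (F.map f)).comp x (zero_add i)).comp (Ext.mk₀ g) (add_zero i)) =
          ((Ext.mk₀ f).comp (ψ i C D x) (zero_add i)).comp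
            (Ext.mk₀ (G.map g)) (add_zero i)) ∧
      -- compatibility with Yoneda products
      (∀ (m n : ℕ) (C C' : 𝒞) (D : 𝒟) (η : Ext.{w} C' C m) (θ : Ext.{w} C (G.obj D) n),
        (η.mapExactFunctor F).comp ((ψ n C D).symm θ) rfl =
          (ψ (m + n) C' D).symm (η.comp θ rfl))) ∧
    -- (c)
    (∀ (n : ℕ) (C : 𝒞) (D : 𝒟),
      (YonedaExt.extGE.{w} n C (G.obj D)).FG → (YonedaExt.extGE.{w'} n (F.obj C) D).FG) ∧
    -- (d)
    (∀ C : 𝒞,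
      IsNoetherianRing (YonedaExt.ExtStar.{w} C C)ᵐᵒᵖ →
      Module.Finite (YonedaExt.ExtStar.{w} C C)ᵐᵒᵖ
        (YonedaExt.ExtStar.{w} C (G.obj (F.obj C))) →
      IsNoetherianRing (YonedaExt.ExtStar.{w'} (F.obj C) (F.obj C))ᵐᵒᵖ) := by
  refine ⟨⟨fun i C D => adj.extEquiv i C D, ?_, ?_, ?_, ?_⟩, ?_, ?_⟩
  · intro C D f
    rw [← AddEquiv.eq_symm_apply, adj.extEquiv_symm_apply, adj.extHom_mk₀, Equiv.symm_apply_apply]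
  · intro C D P i f hf
    rw [← AddEquiv.eq_symm_apply, adj.extEquiv_symm_apply]
    exact (adj.extHom_extMk P _ _ _ _ f hf rfl).symm
  · intro i C C' D D' f g x
    rw [← AddEquiv.eq_symm_apply, adj.extEquiv_symm_apply, adj.extHom_comp_mk₀, adj.extHom_comp,
      Ext.mapExactFunctor_mk₀, adj.extHom_extEquiv]
  · intro m n C C' D η θ
    rw [adj.extEquiv_symm_apply, adj.extEquiv_symm_apply, adj.extHom_comp]
  · intro n C D h
    refine Submodule.fg_of_fg_comap_of_surjective _ (YonedaExt.adjHom_surjective adj C D) _ ?_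
    rwa [show (YonedaExt.extGE n (F.obj C) D).comap (YonedaExt.adjHom.{w, w'} adj C D) =
        YonedaExt.extGE n C (G.obj D) from
      Submodule.ext fun x => YonedaExt.adjHom_mem_extGE_iff adj x]
  -- A finite module over a Noetherian ring is Noetherian; this passes to Ext^*(F(C), F(C)) as a
  -- right module over itself, which `e` identifies with the regular module of the opposite ring.
  · intro C hC hG
    have : IsNoetherian (YonedaExt.ExtStar.{w'} (F.obj C) (F.obj C))ᵐᵒᵖ
        (YonedaExt.ExtStar.{w'} (F.obj C) (F.obj C)) :=
      .of_surjective_semilinear _ (YonedaExt.adjHom_surjective.{w, w'} adj C (F.obj C))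
    let e : YonedaExt.ExtStar.{w'} (F.obj C) (F.obj C) ≃ₗ[(YonedaExt.ExtStar.{w'} (F.obj C)
        (F.obj C))ᵐᵒᵖ] (YonedaExt.ExtStar.{w'} (F.obj C) (F.obj C))ᵐᵒᵖ :=
      { MulOpposite.opAddEquiv with map_smul' := fun _ _ => rfl }
    exact isNoetherian_of_linearEquiv e
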